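/- All graphs are finite and simple. For a graph $G$ and an integer $p\ge 1$, a coloring $f:V(G)\to\mathbb{N}$ is *$p$-centered* if for every (non-empty) connected subgraph $H$ of $G$, either $|f(V(H))|>p$ or some color appears on exactly one vertex of $H$. A graph $H$ is an *$r$-shallow minor* of $G$ if there are pairwise vertex-disjoint connected subgraphs $(I_h)_{h\in V(H)}$ of $G$, each of radius at most $r$, such that for every edge $h_1h_2$ of $H$ there is an edge of $G$ with one endpoint in $I_{h_1}$ and the other in $I_{h_2}$. Let $\nabla_r(G)$ be the maximum of $|E(H)|/|V(H)|$ over the (non-empty) $r$-shallow minors $H$ of $G$ (and $0$ if $G$ is empty), and for a graph class $\mathcal{G}$ let $\nabla_r(\mathcal{G})=\sup_{G\in\mathcal{G}}\nabla_r(G)$. The class $\mathcal{G}$ has *polynomial expansion* if there is a polynomial $q$ with $\nabla_r(\mathcal{G})\le q(r)$ for every integer $r\ge 0$. **Theorem.** There exist a graph class $\mathcal{G}$ (closed under isomorphism) and a constant $c>0$ such that $\nabla_r(\mathcal{G})\le r+2$ for every integer $r\ge 0$ (in particular, $\mathcal{G}$ has polynomial expansion), but for every integer $p\ge 1$ there is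 a graph $G\in\mathcal{G}$ such that every $p$-centered coloring of $G$ uses at least $2^{c\sqrt{p}}$ colors. -/

import Mathlib

open scoped ENNReal

noncomputable section

namespace Sparsity

/-- A coloring `f` of the finite graph `G` is `p`-centered if on every connected subgraph `H` of `G`
it either attains more than `p` colors or has a color appearing exactly once. (Mathlib's
`Subgraph.Connected` includes that the subgraph has a vertex.) -/
def IsPCentered {V : Type} (G : SimpleGraph V) (p : ℕ) (f : V → ℕ) : Prop :=
  ∀ H : G.Subgraph, H.Connected →
    p < (f '' H.verts).ncard ∨ ∃ i : ℕ, (f ⁻¹' {i} ∩ H.verts).ncard = 1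

/-- `I` is an `r`-shallow minor model of `H` in `G`: the `I h` are connected, pairwise
vertex-disjoint subgraphs of `G`, of radius at most `r` (distances measured inside `I h`), and for
every edge `h₁h₂` of `H` there is an edge of `G` between `I h₁` and `I h₂`. -/
structure IsShallowMinorModel {W V : Type} (r : ℕ) (H : SimpleGraph W) (G : SimpleGraph V)
    (I : W → G.Subgraph) : Prop where
  connected : ∀ h, (I h).Connected
  disjoint : ∀ h₁ h₂, h₁ ≠ h₂ → Disjoint (I h₁).verts (I h₂).verts
  radius_le : ∀ h, (I h).coe.radius ≤ (r : ℕ∞)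
  exists_adj : ∀ h₁ h₂, H.Adj h₁ h₂ → ∃ u ∈ (I h₁).verts, ∃ v ∈ (I h₂).verts, G.Adj u v

/-- `H` is an `r`-shallow minor of `G`. -/
def IsShallowMinor {W V : Type} (r : ℕ) (H : SimpleGraph W) (G : SimpleGraph V) : Prop :=
  ∃ I : W → G.Subgraph, IsShallowMinorModel r H G I

/-- The density `|E(H)| / |V(H)|` of a finite graph. -/
def density {W : Type} (H : SimpleGraph W) : ℝ≥0∞ :=
  (H.edgeSet.ncard : ℝ≥0∞) / (Nat.card W : ℝ≥0∞)

/-- `∇_r(G)`: the supremum of the densities of the finite non-empty `r`-shallow minors of `G`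
(a maximum when `G` is finite and non-empty). -/
def nabla {V : Type} (r : ℕ) (G : SimpleGraph V) : ℝ≥0∞ :=
  ⨆ (W : Type) (_ : Finite W) (_ : Nonempty W) (H : SimpleGraph W) (_ : IsShallowMinor r H G),
    density H

/-- A graph class: an isomorphism-closed class of finite graphs. -/
structure GraphClass where
  Mem : ∀ {V : Type}, SimpleGraph V → Prop
  finite : ∀ {V : Type} (G : SimpleGraph V), Mem G → Finite V
  iso_closed : ∀ {V V' : Type} (G : SimpleGraph V) (G' : SimpleGraph V'),
    Nonempty (G ≃g G') → Mem G → Mem G'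

/-- `∇_r(𝒢)`, the supremum of `∇_r(G)` over the graphs `G` of the class (possibly infinite). -/
def GraphClass.nabla (r : ℕ) (𝒢 : GraphClass) : ℝ≥0∞ :=
  ⨆ (V : Type) (G : SimpleGraph V) (_ : 𝒢.Mem G), Sparsity.nabla r G

/-- A class has polynomial expansion if `∇_r(𝒢)` is bounded by a polynomial in `r`. -/
def GraphClass.PolynomialExpansion (𝒢 : GraphClass) : Prop :=
  ∃ q : Polynomial ℝ, ∀ r : ℕ, 𝒢.nabla r ≤ ENNReal.ofReal (q.eval (r : ℝ))

end Sparsity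

end

namespace Sparsity

open SimpleGraph

/-! ### Density of shallow minors from a ranking -/

section Density

variable {V W : Type}

/-! The graphs are `(4k+1)`-subdivisions of binomial trees on `2^k` vertices, blown up along an
`N`-ary tree: a vertex at level `l` gets one copy per word of length `l`, and copies of adjacent
vertices are joined when one word is a prefix of the other.

Many colors (`le_ncard_range_of_isPCentered`): a branch of the `N`-ary tree carries a copy of the
subdivided tree, and for large `N` there is one coloring `τ` of it such that at every depth two
branches colored by `τ` split. With fewer than `2^k` colors, two tree vertices get the same
`τ`-color. Join them by the walk through the root and take two copies of it, on branches splitting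
just at the level of the lower end. The copies share only that end, whose color recurs at the other
end, so no color is unique. The walk has length `O(k^2)`, so `k` of order `√p` suffices.

Low density (`density_le_of_rank`): orient each edge of a minor towards the branch set whose minimum
has the smaller rank. Out-degrees are at most 2 if that minimum is a subdivision vertex. If it is a
forest vertex, they are at most `k`, the number of crossing arcs, which settles `k ≤ r + 2`; for
larger `k` they vanish, because forest vertices are too far apart. -/

theorem verts_subset_of_closed {G : SimpleGraph V} {H : G.Subgraph} (hH : H.Connected)
    {D : Set V} {x : V} (hx : x ∈ H.verts) (hxD : x ∈ D)
    (hD : ∀ u v, v ∈ H.verts → u ∈ D → G.Adj u v → v ∈ D) : H.verts ⊆ D := by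
  intro y hy
  obtain ⟨p⟩ := hH.coe.preconnected ⟨x, hx⟩ ⟨y, hy⟩
  suffices h : ∀ (a b : H.verts) (_ : H.coe.Walk a b), (a : V) ∈ D → (b : V) ∈ D from
    h _ _ p hxD
  intro a b p
  induction p with
  | nil => exact id
  | cons hadj _ ih => exact fun ha => ih (hD _ _ (Subtype.coe_prop _) ha (H.adj_sub hadj))

theorem exists_walk_length_le_of_radius_le {G : SimpleGraph V} {H : G.Subgraph} {r : ℕ}
    (hr : H.coe.radius ≤ r) {x y : V} (hx : x ∈ H.verts) (hy : y ∈ H.verts) :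
    ∃ p : G.Walk x y, p.length ≤ 2 * r := by
  have : Nonempty H.verts := ⟨⟨x, hx⟩⟩
  obtain ⟨c, hc⟩ := H.coe.exists_eccent_eq_radius
  have h1 : H.coe.edist ⟨x, hx⟩ ⟨y, hy⟩ ≤ ((2 * r : ℕ) : ℕ∞) := by
    refine edist_le_ediam.trans ((ediam_le_two_mul_eccent c).trans ?_)
    rw [hc]
    push_cast
    gcongr
  obtain ⟨p, hp⟩ := exists_walk_of_edist_ne_top (ne_top_of_le_ne_top (ENat.natCast_ne_top _) h1)
  refine ⟨p.map H.hom, ?_⟩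
  refine (Walk.length_map H.hom p).trans_le ?_
  rw [← hp] at h1
  exact_mod_cast h1

theorem ncard_edgeSet_le_of_orientation [Finite W] (H : SimpleGraph W) (O : W → Set W) (d : ℕ)
    (hO : ∀ a b, H.Adj a b → b ∈ O a ∨ a ∈ O b) (hd : ∀ a, (O a).ncard ≤ d) :
    H.edgeSet.ncard ≤ d * Nat.card W := by
  classical
  have := Fintype.ofFinite W
  have hsub : H.edgeSet ⊆
      ((Finset.univ.biUnion fun a => (O a).toFinset.image fun b => s(a, b) : Finset (Sym2 W)) :
        Set (Sym2 W)) := by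
    intro e
    induction e using Sym2.ind with
    | _ a b =>
      intro h
      simp only [Finset.coe_biUnion, Set.mem_iUnion, Finset.mem_coe, Finset.mem_image,
        Set.mem_toFinset]
      rcases hO a b h with h | h
      · exact ⟨a, Finset.mem_univ _, b, h, rfl⟩
      · exact ⟨b, Finset.mem_univ _, a, h, Sym2.eq_swap⟩
  refine (Set.ncard_le_ncard hsub (Finset.finite_toSet _)).trans ?_
  rw [Set.ncard_coe_finset, Nat.card_eq_fintype_card, mul_comm, ← Finset.card_univ]
  refine Finset.card_biUnion_le_card_mul _ _ _ fun a _ => Finset.card_image_le.trans ?_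
  rw [← Set.ncard_eq_toFinset_card']
  exact hd a

/-- Density of shallow minors from a ranking `ρ` of the vertices: `D m` plays the role of the set of
descendants of `m`, and `A m` that of the ancestors of `m` attached to it. -/
theorem density_le_of_rank {V' : Type} [Finite W] [Finite V'] {r d : ℕ}
    {H : SimpleGraph W} {G : SimpleGraph V} {G' : SimpleGraph V'} {I : W → G.Subgraph}
    (hI : IsShallowMinorModel r H G I) (φ : G →g G') (hφ : Function.Injective φ)
    (ρ : V' → ℕ) (D A : V' → Set V') (hself : ∀ m, m ∈ D m)
    (hD : ∀ m y, y ∈ D m → y = m ∨ ρ m < ρ y) (hA : ∀ m y, y ∈ A m → ρ y < ρ m)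
    (hN : ∀ m x y, x ∈ D m → G'.Adj x y → y ∈ D m ∨ y ∈ A m)
    (hcard : ∀ m, (A m).ncard ≤ d ∨
      ∀ m', m' ≠ m → ρ m' ≤ ρ m → ∀ p : G'.Walk m m', 4 * r + 1 < p.length) :
    density H ≤ d := by
  have hmin : ∀ h, ∃ m ∈ (I h).verts, ∀ y ∈ (I h).verts, ρ (φ m) ≤ ρ (φ y) := by
    intro h
    have hne : (I h).verts.Nonempty := (hI.connected h).nonempty
    refine ⟨Function.argminOn (ρ ∘ φ) (I h).verts hne, Function.argminOn_mem _ _ _,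
      fun y hy => Function.argminOn_le (ρ ∘ φ) _ hy⟩
  choose m hm hmle using hmin
  let O : W → Set W := fun h => {h' | H.Adj h h' ∧ ρ (φ (m h')) ≤ ρ (φ (m h))}
  have hmeet : ∀ h h', h' ∈ O h → ∃ y ∈ (I h').verts, φ y ∈ A (φ (m h)) := by
    rintro h h' ⟨hadj, hle⟩
    by_contra! hcon
    -- Leaving `D` means entering `A`, whose ranks lie below the minimum over `I h`.
    have hsub : (I h).verts ⊆ φ ⁻¹' D (φ (m h)) := by
      refine verts_subset_of_closed (hI.connected h) (hm h) (hself _) fun u v hv hu huv => ?_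
      exact (hN _ _ _ hu (φ.map_adj huv)).resolve_right
        fun hvA => (hA _ _ hvA).not_ge (hmle h v hv)
    obtain ⟨u, hu, v, hv, huv⟩ := hI.exists_adj h h' hadj
    have hvD := (hN _ _ _ (hsub hu) (φ.map_adj huv)).resolve_right (hcon v hv)
    -- If it avoids `A`, the neighboring branch set is trapped in `D` as well, so its minimum ranks
    -- too high.
    have hsub' : (I h').verts ⊆ φ ⁻¹' D (φ (m h)) :=
      verts_subset_of_closed (hI.connected h') hv hvD fun u v hv hu huv =>
        (hN _ _ _ hu (φ.map_adj huv)).resolve_right (hcon v hv)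
    rcases hD _ _ (hsub' (hm h')) with heq | hlt
    · exact Set.disjoint_left.1 (hI.disjoint h h' hadj.ne) (hm h) (hφ heq ▸ hm h')
    · exact hlt.not_ge hle
  have hO : ∀ h, (O h).ncard ≤ d := by
    intro h
    rcases hcard (φ (m h)) with hc | hc
    · have : Nonempty V := ⟨m h⟩
      choose! y hy hyA using hmeet h
      refine le_trans (Set.ncard_le_ncard_of_injOn (fun h' => φ (y h')) hyA ?_
        (Set.toFinite _)) hc
      intro a ha b hb hab
      by_contra hne
      exact Set.disjoint_left.1 (hI.disjoint a b hne) (hy a ha) (hφ hab ▸ hy b hb)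
    · have : O h = ∅ := by
        refine Set.eq_empty_of_forall_notMem ?_
        rintro h' ⟨hadj, hle⟩
        obtain ⟨u, hu, v, hv, huv⟩ := hI.exists_adj h h' hadj
        obtain ⟨p, hp⟩ := exists_walk_length_le_of_radius_le (hI.radius_le h) (hm h) hu
        obtain ⟨q, hq⟩ := exists_walk_length_le_of_radius_le (hI.radius_le h') hv (hm h')
        have hne : φ (m h') ≠ φ (m h) := fun heq =>
          Set.disjoint_left.1 (hI.disjoint h h' hadj.ne) (hm h) (hφ heq ▸ hm h')
        have := hc _ hne hle ((p.append (Walk.cons huv q)).map φ)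
        simp only [Walk.length_map, Walk.length_append, Walk.length_cons] at this
        lia
      simp [this]
  have hE := ncard_edgeSet_le_of_orientation H O d
    (fun a b hab => (le_total (ρ (φ (m b))) (ρ (φ (m a)))).imp
      (fun h => ⟨hab, h⟩) (fun h => ⟨hab.symm, h⟩)) hO
  refine ENNReal.div_le_of_le_mul ?_
  exact_mod_cast hE

end Density

/-! ### Blow-ups along a tree and centered colorings -/

section TreeBlowup

variable {α : Type} {ℓ : α → ℕ} {N : ℕ}

/-- Two labelled words agree on their common prefix. -/
def Agree (x y : Σ a, (Fin (ℓ a) → Fin N)) : Prop :=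
  ∀ j (hx : j < ℓ x.1) (hy : j < ℓ y.1), x.2 ⟨j, hx⟩ = y.2 ⟨j, hy⟩

theorem Agree.refl (x : Σ a, (Fin (ℓ a) → Fin N)) : Agree x x := fun _ _ _ => rfl

theorem Agree.symm {x y : Σ a, (Fin (ℓ a) → Fin N)} (h : Agree x y) : Agree y x :=
  fun j hx hy => (h j hy hx).symm

/-- The length condition is needed: two words extending a shorter `y` may differ beyond it. -/
theorem Agree.trans {x y z : Σ a, (Fin (ℓ a) → Fin N)} (h : Agree x y) (h' : Agree y z)
    (hl : ℓ x.1 ≤ ℓ y.1 ∨ ℓ z.1 ≤ ℓ y.1) : Agree x z := fun j hx hz =>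
  have hy : j < ℓ y.1 := by lia
  (h j hx hy).trans (h' j hy hz)

theorem Agree.eq {x y : Σ a, (Fin (ℓ a) → Fin N)} (h : Agree x y) (hxy : x.1 = y.1) : x = y := by
  obtain ⟨a, v⟩ := x
  obtain ⟨b, w⟩ := y
  obtain rfl : a = b := hxy
  congr 1
  funext j
  exact h j j.2 j.2

/-- A word agreeing with that of `m` and no longer is a truncation of it, so only the base vertices
need counting. -/
theorem ncard_le_of_agree {A : Set (Σ a, (Fin (ℓ a) → Fin N))} {m : Σ a, (Fin (ℓ a) → Fin N)}
    {β : Type} (g : α → β) (hg : ∀ x ∈ A, ∀ y ∈ A, g x.1 = g y.1 → x.1 = y.1) (T : Finset β)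
    (hA : ∀ y ∈ A, Agree m y ∧ ℓ y.1 ≤ ℓ m.1 ∧ g y.1 ∈ T) : A.ncard ≤ T.card := by
  rw [← Set.ncard_coe_finset]
  refine Set.ncard_le_ncard_of_injOn (fun y => g y.1) (fun y hy => (hA y hy).2.2) ?_
    (Finset.finite_toSet _)
  intro x hx y hy hxy
  exact ((hA x hx).1.symm.trans (hA y hy).1 (Or.inl (hA x hx).2.1)).eq (hg x hx y hy hxy)

/-- The blow-up of the graph `Q` with levels `ℓ` along the `N`-ary tree: the copies of the vertex `a`
are indexed by the tree nodes at depth `ℓ a`, and copies of adjacent vertices are adjacent if their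
nodes are comparable in the tree. -/
def treeBlowup (Q : SimpleGraph α) (ℓ : α → ℕ) (N : ℕ) :
    SimpleGraph (Σ a, (Fin (ℓ a) → Fin N)) where
  Adj x y := Q.Adj x.1 y.1 ∧ Agree x y
  symm := ⟨fun _ _ h => ⟨h.1.symm, h.2.symm⟩⟩
  loopless := ⟨fun _ h => Q.loopless.irrefl _ h.1⟩

/-- The copy of `Q` along the branch `z` of the tree. -/
def branch (Q : SimpleGraph α) (ℓ : α → ℕ) (z : ℕ → Fin N) : Q →g treeBlowup Q ℓ N where
  toFun a := ⟨a, fun j => z j⟩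
  map_rel' h := ⟨h, fun _ _ _ => rfl⟩

theorem branch_eq_of_agree {Q : SimpleGraph α} {z z' : ℕ → Fin N} {a : α}
    (h : ∀ j < ℓ a, z j = z' j) : branch Q ℓ z a = branch Q ℓ z' a :=
  Agree.eq (fun j hj _ => h j hj) rfl

theorem branch_ne_of_lt {Q : SimpleGraph α} {z z' : ℕ → Fin N} {a : α} {i : ℕ} (hi : i < ℓ a)
    (h : z i ≠ z' i) : branch Q ℓ z a ≠ branch Q ℓ z' a := by
  intro heq
  have h' : Agree (branch Q ℓ z a) (branch Q ℓ z' a) := heq ▸ Agree.refl _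
  exact h (h' i hi hi)

/-- Every finite colouring of the branches of a tree of large arity has, up to depth `L`, pairs of
branches of one fixed colour splitting at each prescribed depth. -/
theorem exists_homogeneous_branching {T : Type} [Finite T] (hT : Nat.card T < N)
    (F : (ℕ → Fin N) → T) (L : ℕ) :
    ∃ τ, ∀ i < L, ∃ z z' : ℕ → Fin N, (∀ j < i, z j = z' j) ∧ z i ≠ z' i ∧ F z = τ ∧ F z' = τ := by
  -- Induction from the bottom of the tree: two of the `N` children of a node inherit the same `τ`.
  -- They give the split at depth `l`, and one of them supplies all deeper splits.
  suffices key : ∀ n l, l + n = L → ∀ z : ℕ → Fin N, ∃ τ,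
      (∃ y, (∀ j < l, y j = z j) ∧ F y = τ) ∧
      ∀ i, l ≤ i → i < L → ∃ y y' : ℕ → Fin N,
        (∀ j < i, y j = y' j) ∧ y i ≠ y' i ∧ F y = τ ∧ F y' = τ by
    obtain ⟨τ, -, h⟩ := key L 0 (by simp) fun _ => ⟨0, by lia⟩
    exact ⟨τ, fun i hi => h i (Nat.zero_le _) hi⟩
  intro n
  induction n with
  | zero => exact fun l hl z => ⟨F z, ⟨z, fun _ _ => rfl, rfl⟩, by lia⟩
  | succ n ih =>
    intro l hl z
    choose τ hτ h using fun a : Fin N => ih (l + 1) (by lia) (Function.update z l a)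
    obtain ⟨a, b, hab, heq⟩ : ∃ a b, a ≠ b ∧ τ a = τ b := by
      have := Fintype.ofFinite T
      exact Fintype.exists_ne_map_eq_of_card_lt τ (by simpa using hT)
    obtain ⟨y, hy, hFy⟩ := hτ a
    obtain ⟨y', hy', hFy'⟩ := hτ b
    have hlt : ∀ j < l, ∀ c, Function.update z l c j = z j := fun j hj c =>
      Function.update_of_ne hj.ne _ _
    refine ⟨τ a, ⟨y, fun j hj => (hy j (by lia)).trans (hlt j hj a), hFy⟩, fun i hi hiL => ?_⟩
    rcases hi.eq_or_lt with rfl | hi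
    · refine ⟨y, y', fun j hj => ?_, ?_, hFy, hFy'.trans heq.symm⟩
      · rw [hy j (by lia), hy' j (by lia), hlt j hj, hlt j hj]
      · rw [hy l (by lia), hy' l (by lia)]
        simpa using hab
    · exact h a i hi hiL

/-- If vertices `b 0, …, b (n - 1)` of `Q` are pairwise joined by short walks whose other vertices
have a higher level than the first end, then centered colourings of the blow-up of `Q` use at least
`n` colours. -/
theorem le_ncard_range_of_isPCentered [Finite α] {Q : SimpleGraph α} {n p : ℕ}
    (b : Fin n → α) (hb : Function.Injective b)
    (hwalk : ∀ i j, i < j → ∃ w : Q.Walk (b i) (b j), w.length ≤ p ∧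
      ∀ a ∈ w.support, a = b i ∨ ℓ (b i) < ℓ a)
    (hN : n ^ Nat.card α < N) {f : (Σ a, (Fin (ℓ a) → Fin N)) → ℕ}
    (hf : IsPCentered (treeBlowup Q ℓ N) p f) : n ≤ (Set.range f).ncard := by
  classical
  by_contra! hlt
  have hfin : (Set.range f).Finite := Set.finite_range f
  have := hfin.to_subtype
  obtain ⟨L, hL⟩ : ∃ L, ∀ a, ℓ a < L := by
    obtain ⟨M, hM⟩ := (Set.finite_range ℓ).bddAbove
    exact ⟨M + 1, fun a => Nat.lt_succ_of_le (hM ⟨a, rfl⟩)⟩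
  have hT : Nat.card (α → Set.range f) < N := by
    rw [Nat.card_fun]
    exact (Nat.pow_le_pow_left hlt.le _).trans_lt hN
  obtain ⟨τ, hτ⟩ := exists_homogeneous_branching hT
    (fun z a => (⟨f (branch Q ℓ z a), Set.mem_range_self _⟩ : Set.range f)) L
  obtain ⟨i, j, hij, hc⟩ : ∃ i j, i < j ∧ τ (b i) = τ (b j) := by
    have := Fintype.ofFinite (Set.range f)
    obtain ⟨i, j, hij, hc⟩ := Fintype.exists_ne_map_eq_of_card_lt (fun i => τ (b i)) (by
      rw [← Nat.card_eq_fintype_card, Fintype.card_fin]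
      exact hlt)
    rcases hij.lt_or_gt with h | h
    · exact ⟨i, j, h, hc⟩
    · exact ⟨j, i, h, hc.symm⟩
  obtain ⟨z, z', hzz, hne, hz, hz'⟩ := hτ _ (hL (b i))
  replace hz : ∀ a, f (branch Q ℓ z a) = τ a := fun a => congrArg Subtype.val (congrFun hz a)
  replace hz' : ∀ a, f (branch Q ℓ z' a) = τ a := fun a => congrArg Subtype.val (congrFun hz' a)
  obtain ⟨w, hwl, hw⟩ := hwalk i j hij
  have hbi : branch Q ℓ z (b i) = branch Q ℓ z' (b i) := branch_eq_of_agree hzz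
  -- The two copies of the walk are glued at the common copy of `b i`.
  let K := (w.map (branch Q ℓ z)).toSubgraph ⊔ (w.map (branch Q ℓ z')).toSubgraph
  have hKv : K.verts = branch Q ℓ z '' {a | a ∈ w.support} ∪
      branch Q ℓ z' '' {a | a ∈ w.support} := by
    ext x
    simp [K]
  have hKc : K.Connected := by
    refine Subgraph.connected_sup (Walk.toSubgraph_connected _).preconnected
      (Walk.toSubgraph_connected _).preconnected ⟨branch Q ℓ z (b i), ?_, ?_⟩
    · exact Walk.start_mem_verts_toSubgraph _
    · rw [hbi]
      exact Walk.start_mem_verts_toSubgraph _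
  rcases hf K hKc with hp | ⟨c, hc1⟩
  -- The start of the walk can be dropped, since `b j` has its color; this leaves at most `w.length
  -- ≤ p` colors.
  · have hsub : f '' K.verts ⊆ ((w.support.tail.toFinset.image fun a => (τ a : ℕ) : Finset ℕ) :
        Set ℕ) := by
      rw [hKv]
      have haux : ∀ a ∈ w.support, ((τ a : ℕ)) ∈ w.support.tail.toFinset.image
          fun a => (τ a : ℕ) := by
        intro a ha
        simp only [Finset.mem_image, List.mem_toFinset]
        have hji : b j ≠ b i := fun h => hij.ne' (hb h)
        rcases (w.mem_support_iff).1 ha with rfl | ha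
        · refine ⟨b j, ?_, by rw [hc]⟩
          exact ((w.mem_support_iff).1 w.end_mem_support).resolve_left hji
        · exact ⟨a, ha, rfl⟩
      rintro _ ⟨x, ⟨a, ha, rfl⟩ | ⟨a, ha, rfl⟩, rfl⟩
      · rw [hz]
        exact haux a ha
      · rw [hz']
        exact haux a ha
    have h1 := Set.ncard_le_ncard hsub (Finset.finite_toSet _)
    rw [Set.ncard_coe_finset] at h1
    have h2 := (Finset.card_image_le (s := w.support.tail.toFinset)
      (f := fun a => (τ a : ℕ))).trans (List.toFinset_card_le _)
    simp only [List.length_tail, Walk.length_support] at h2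
    lia
  · have htwin : ∀ x ∈ K.verts, ∃ y ∈ K.verts, y ≠ x ∧ f y = f x := by
      have hj := w.end_mem_support
      have hlj := (hw _ hj).resolve_left fun h => hij.ne' (hb h)
      rw [hKv]
      rintro x (⟨a, ha, rfl⟩ | ⟨a, ha, rfl⟩)
      · rcases hw a ha with rfl | hla
        · refine ⟨branch Q ℓ z (b j), Or.inl ⟨_, hj, rfl⟩, fun h => ?_, by rw [hz, hz, hc]⟩
          exact hij.ne' (hb (congrArg Sigma.fst h))
        · exact ⟨branch Q ℓ z' a, Or.inr ⟨_, ha, rfl⟩, (branch_ne_of_lt hla hne).symm,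
            by rw [hz, hz']⟩
      · rcases hw a ha with rfl | hla
        · refine ⟨branch Q ℓ z (b j), Or.inl ⟨_, hj, rfl⟩, fun h => ?_, by rw [hz, hz', hc]⟩
          exact hij.ne' (hb (congrArg Sigma.fst h))
        · exact ⟨branch Q ℓ z a, Or.inl ⟨_, ha, rfl⟩, branch_ne_of_lt hla hne,
            by rw [hz, hz']⟩
    obtain ⟨x, hx⟩ := Set.ncard_eq_one.1 hc1
    have hxm : x ∈ f ⁻¹' {c} ∩ K.verts := hx ▸ rfl
    obtain ⟨y, hy, hyx, hfy⟩ := htwin x hxm.2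
    have hym : y ∈ f ⁻¹' {c} ∩ K.verts := ⟨hfy.trans hxm.1, hy⟩
    rw [hx] at hym
    exact hyx hym

end TreeBlowup

/-! ### Binomial trees -/

/-- The parent function `par` on an initial segment of the naturals is increasing, and below `L` at
most `k` of its arcs pass over any point. -/
structure IsIncreasingForest (par : ℕ → ℕ) (L k : ℕ) : Prop where
  lt_par : ∀ i, i < par i
  crossing : ∀ j < L, ((Finset.range j).filter fun i => j ≤ par i).card ≤ k

/-- The binomial tree of order `k`, in postorder. -/
theorem exists_binomialTree (k : ℕ) : ∃ par d : ℕ → ℕ, IsIncreasingForest par (2 ^ k) k ∧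
    (∀ i < 2 ^ k, d i ≤ k) ∧ ∀ i, i + 1 < 2 ^ k → par i < 2 ^ k ∧ d i = d (par i) + 1 := by
  induction k with
  | zero =>
    refine ⟨fun i => i + 1, fun _ => 0, ⟨fun i => Nat.lt_succ_self i, fun j hj => ?_⟩,
      by simp, fun i hi => by simp at hi⟩
    obtain rfl : j = 0 := by simpa using hj
    simp
  | succ k ih =>
    obtain ⟨par, d, ⟨hlt, hcr⟩, hd, hpar⟩ := ih
    have hpos : 0 < 2 ^ k := by positivity
    rw [pow_succ]
    generalize 2 ^ k = L at *
    refine ⟨fun i => if i + 1 < L then par i else if i + 1 = L then 2 * L - 1 else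
      L + par (i - L), fun i => if i < L then d i + 1 else d (i - L), ⟨fun i => ?_, fun j hj => ?_⟩,
      fun i hi => ?_, fun i hi => ?_⟩
    · have h1 := hlt i
      have h2 := hlt (i - L)
      split_ifs <;> lia
    · rcases lt_or_ge j L with hjL | hjL
      · refine (Finset.card_le_card ?_).trans ((hcr j hjL).trans (Nat.le_succ k))
        intro i hi
        simp only [Finset.mem_filter, Finset.mem_range] at hi ⊢
        rw [if_pos (by lia)] at hi
        exact hi
      -- Over a point of the second copy, the only arc from the first copy is that of its root `L -
      -- 1`.
      · have hsub : ((Finset.range j).filter fun i => j ≤ if i + 1 < L then par i else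
            if i + 1 = L then 2 * L - 1 else L + par (i - L)) ⊆ insert (L - 1)
            (((Finset.range (j - L)).filter fun i => j - L ≤ par i).image (L + ·)) := by
          intro i hi
          simp only [Finset.mem_filter, Finset.mem_range, Finset.mem_insert,
            Finset.mem_image] at hi ⊢
          obtain ⟨hij, hi⟩ := hi
          split_ifs at hi with h1 h2
          · have := (hpar i h1).1
            lia
          · left; lia
          · right
            exact ⟨i - L, by lia, by lia⟩
        refine (Finset.card_le_card hsub).trans ((Finset.card_insert_le _ _).trans ?_)
        exact Nat.succ_le_succ (Finset.card_image_le.trans (hcr (j - L) (by lia)))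
    · dsimp only
      split_ifs with h
      · exact Nat.succ_le_succ (hd i h)
      · exact (hd (i - L) (by lia)).trans (Nat.le_succ k)
    · dsimp only
      rcases lt_trichotomy (i + 1) L with h | h | h
      · have := hpar i h
        rw [if_pos h, if_pos (by lia), if_pos this.1]
        lia
      · rw [if_neg (by lia), if_pos h, if_pos (by lia), if_neg (by lia)]
        refine ⟨by lia, ?_⟩
        congr 2
        lia
      · have := hpar (i - L) (by lia)
        rw [if_neg (by lia), if_neg (by lia), if_neg (by lia), if_neg (by lia), this.2]
        refine ⟨by lia, ?_⟩
        congr 2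
        lia

/-! ### Blow-ups of subdivided forests -/

section SubdividedForest

variable {par : ℕ → ℕ} {L s N : ℕ}

/-- The `s`-subdivision of the forest on `Fin L` with parent function `par`. The vertex `(i, 0)` is
the forest vertex `i`, and `(i, 1), …, (i, s)` subdivide the edge from `i` to `par i`. -/
def subdividedForest (par : ℕ → ℕ) (L s : ℕ) : SimpleGraph (Fin L × Fin (s + 1)) :=
  SimpleGraph.fromRel fun x y => ((y.1 : ℕ) = x.1 ∧ (y.2 : ℕ) = x.2 + 1) ∨
    ((x.2 : ℕ) = s ∧ (y.2 : ℕ) = 0 ∧ (y.1 : ℕ) = par x.1)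

/-- Forest vertices are their own level, and a subdivision vertex has the level of the upper end of
its edge. -/
def forestLevel (par : ℕ → ℕ) {L s : ℕ} (x : Fin L × Fin (s + 1)) : ℕ :=
  if (x.2 : ℕ) = 0 then x.1 else par x.1

theorem subdividedForest_adj_succ {x y : Fin L × Fin (s + 1)} (h1 : (y.1 : ℕ) = x.1)
    (h2 : (y.2 : ℕ) = x.2 + 1) : (subdividedForest par L s).Adj x y := by
  refine (SimpleGraph.fromRel_adj _ _ _).2 ⟨?_, Or.inl (Or.inl ⟨h1, h2⟩)⟩
  rintro rfl
  lia

theorem subdividedForest_adj_par (hs : 0 < s) {x y : Fin L × Fin (s + 1)} (h1 : (x.2 : ℕ) = s)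
    (h2 : (y.2 : ℕ) = 0) (h3 : (y.1 : ℕ) = par x.1) : (subdividedForest par L s).Adj x y := by
  refine (SimpleGraph.fromRel_adj _ _ _).2 ⟨?_, Or.inl (Or.inr ⟨h1, h2, h3⟩)⟩
  rintro rfl
  lia

theorem subdividedForest_adj_cases {x y : Fin L × Fin (s + 1)}
    (h : (subdividedForest par L s).Adj x y) :
    ((y.1 : ℕ) = x.1 ∧ (y.2 : ℕ) = x.2 + 1) ∨ ((x.1 : ℕ) = y.1 ∧ (x.2 : ℕ) = y.2 + 1) ∨
    ((x.2 : ℕ) = s ∧ (y.2 : ℕ) = 0 ∧ (y.1 : ℕ) = par x.1) ∨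
    ((y.2 : ℕ) = s ∧ (x.2 : ℕ) = 0 ∧ (x.1 : ℕ) = par y.1) := by
  rcases ((SimpleGraph.fromRel_adj _ _ _).1 h).2 with (h | h) | (h | h) <;> tauto

theorem prod_fin_ext {x y : Fin L × Fin (s + 1)} (h1 : (x.1 : ℕ) = y.1) (h2 : (x.2 : ℕ) = y.2) :
    x = y := Prod.ext (Fin.ext h1) (Fin.ext h2)

theorem exists_walk_subdividedForest_path (i : Fin L) (t : ℕ) (ht : t < s + 1) :
    ∃ w : (subdividedForest par L s).Walk (i, 0) (i, ⟨t, ht⟩), w.length = t ∧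
      ∀ a ∈ w.support, a.1 = i := by
  induction t with
  | zero => exact ⟨Walk.nil, rfl, by simp⟩
  | succ t ih =>
    obtain ⟨w, hw, hws⟩ := ih (by lia)
    refine ⟨w.concat (subdividedForest_adj_succ rfl rfl), by simp [hw], fun a ha => ?_⟩
    rw [Walk.support_concat] at ha
    rcases List.mem_append.1 ha with ha | ha
    · exact hws a ha
    · rw [List.mem_singleton.1 ha]

/-- Climb from parent to parent: levels never drop below `i`, and each of at most `d i` arcs costs
`s + 1` steps. -/
theorem exists_walk_subdividedForest_root (hs : 0 < s) (hlt : ∀ i, i < par i) {d : ℕ → ℕ}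
    (hpar : ∀ i, i + 1 < L → par i < L ∧ d i = d (par i) + 1) (hL : L - 1 < L) (i : Fin L) :
    ∃ w : (subdividedForest par L s).Walk (i, 0) (⟨L - 1, hL⟩, 0), w.length ≤ (s + 1) * d i ∧
      ∀ a ∈ w.support, a = (i, 0) ∨ (i : ℕ) < forestLevel par a := by
  induction hn : d i generalizing i with
  | zero =>
    obtain rfl : i = ⟨L - 1, hL⟩ := by
      by_contra hne
      have hne' : (i : ℕ) ≠ L - 1 := fun h => hne (Fin.ext h)
      have := hpar i (by lia)
      lia
    exact ⟨Walk.nil, by simp, by simp⟩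
  | succ n ih =>
    by_cases hi : (i : ℕ) + 1 < L
    · obtain ⟨hp, hd⟩ := hpar i hi
      obtain ⟨w, hw, hws⟩ := ih ⟨par i, hp⟩ (by simpa using by lia)
      obtain ⟨v, hv, hvs⟩ := exists_walk_subdividedForest_path (par := par) i s s.lt_succ_self
      refine ⟨v.append (Walk.cons (subdividedForest_adj_par hs rfl rfl rfl) w), ?_, ?_⟩
      · simp only [Walk.length_append, Walk.length_cons, hv]
        lia
      · intro a ha
        rw [Walk.mem_support_append_iff, Walk.support_cons, List.mem_cons] at ha
        have hia := hlt i
        have hchain : a.1 = i → a = (i, 0) ∨ (i : ℕ) < forestLevel par a := by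
          rintro rfl
          by_cases h0 : (a.2 : ℕ) = 0
          · exact Or.inl (prod_fin_ext rfl h0)
          · right
            rwa [forestLevel, if_neg h0]
        rcases ha with ha | rfl | ha
        · exact hchain (hvs a ha)
        · exact hchain rfl
        · right
          rcases hws a ha with rfl | h
          · simpa [forestLevel] using hia
          · exact hia.trans h
    · obtain rfl : i = ⟨L - 1, hL⟩ := Fin.ext (by simp; lia)
      exact ⟨Walk.nil, by simp, by simp⟩

/-- The tree blow-up of a subdivided forest. -/
abbrev forestBlowup (par : ℕ → ℕ) (L s N : ℕ) :=
  treeBlowup (subdividedForest par L s) (forestLevel par) N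

theorem lt_length_of_walk_forestBlowup (hlt : ∀ i, i < par i)
    {b y : Σ a : Fin L × Fin (s + 1), (Fin (forestLevel par a) → Fin N)}
    (hb : (b.1.2 : ℕ) = 0) (hy : (y.1.2 : ℕ) = 0) (hne : y ≠ b)
    (p : (forestBlowup par L s N).Walk b y) : s < p.length := by
  -- The invariant after `n ≤ s` steps from `b`: still at `b`, or inside an arc at `b`, going up to
  -- the parent or down to a child. Words on such an arc extend that of `b`, so returning to its end
  -- at `b` gives the same copy.
  let near : ℕ → (Σ a : Fin L × Fin (s + 1), (Fin (forestLevel par a) → Fin N)) → Prop :=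
    fun n x => x = b ∨ (Agree b x ∧ (x.1.2 : ℕ) ≠ 0 ∧
      (((x.1.1 : ℕ) = b.1.1 ∧ (x.1.2 : ℕ) ≤ n) ∨ (par x.1.1 = b.1.1 ∧ s + 1 ≤ x.1.2 + n)))
  have hstep : ∀ n x z, n < s → near n x → (forestBlowup par L s N).Adj x z → near (n + 1) z := by
    rintro n x z hn hx ⟨hxz, hag⟩
    have hc := subdividedForest_adj_cases hxz
    have hxl := hlt x.1.1
    have hzl := hlt z.1.1
    rcases hx with rfl | ⟨hbx, hx0, ⟨hxb, hxn⟩ | ⟨hxb, hxn⟩⟩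
    · right
      refine ⟨hag, ?_⟩
      grind
    · rcases hc with hc | hc | hc | hc
      · right
        refine ⟨hbx.trans hag ?_, by lia, Or.inl (by lia)⟩
        simp only [forestLevel]
        grind
      · by_cases h0 : (z.1.2 : ℕ) = 0
        · left
          refine (Agree.eq (hbx.trans hag ?_) (prod_fin_ext (by lia) (by lia))).symm
          simp only [forestLevel]
          grind
        · right
          refine ⟨hbx.trans hag ?_, h0, Or.inl (by lia)⟩
          simp only [forestLevel]
          grind
      · lia
      · lia
    · rcases hc with hc | hc | hc | hc
      · right
        refine ⟨hbx.trans hag ?_, by lia, Or.inr (by grind)⟩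
        simp only [forestLevel]
        grind
      · right
        refine ⟨hbx.trans hag ?_, by lia, Or.inr (by grind)⟩
        simp only [forestLevel]
        grind
      · left
        refine (Agree.eq (hbx.trans hag ?_) (prod_fin_ext (by lia) (by lia))).symm
        simp only [forestLevel]
        grind
      · lia
  have hwalk : ∀ (x z) (q : (forestBlowup par L s N).Walk x z) (n : ℕ),
      near n x → n + q.length ≤ s → near (n + q.length) z := by
    intro x z q
    induction q with
    | nil => exact fun n h _ => h
    | cons hadj q ih =>
      intro n h hl
      rw [Walk.length_cons] at hl ⊢
      have := ih (n + 1) (hstep n _ _ (by lia) h hadj) (by lia)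
      rwa [show n + (q.length + 1) = n + 1 + q.length by ring]
  by_contra! hle
  rcases hwalk b y p 0 (Or.inl rfl) (by lia) with h | h
  · exact hne h
  · exact h.2.1 hy

theorem density_le_of_isShallowMinorModel_forestBlowup {k r : ℕ}
    (hP : IsIncreasingForest par L k) (hs : 4 * k < s) {V W : Type} [Finite W]
    {H : SimpleGraph W} {G : SimpleGraph V} {I : W → G.Subgraph}
    (hI : IsShallowMinorModel r H G I) (φ : G →g forestBlowup par L s N)
    (hφ : Function.Injective φ) : density H ≤ (r + 2 : ℕ) := by
  let X := Σ a : Fin L × Fin (s + 1), (Fin (forestLevel par a) → Fin N)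
  -- Forest vertices rank before all subdivision vertices, so a forest minimum is compared only with
  -- forest minima. For forest `m`, the set `A m` consists of the lower ends of arcs crossing `m`;
  -- otherwise it consists of the preceding vertex on the arc and the parent.
  let ρ : X → ℕ := fun x => if (x.1.2 : ℕ) = 0 then x.1.1 else L + x.1.2
  let D : X → Set X := fun m => if (m.1.2 : ℕ) = 0 then
      {y | (m.1.1 : ℕ) ≤ forestLevel par y.1 ∧ Agree m y}
    else {y | (y.1.1 : ℕ) = m.1.1 ∧ (m.1.2 : ℕ) ≤ y.1.2 ∧ Agree m y}
  let A : X → Set X := fun m => if (m.1.2 : ℕ) = 0 then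
      {y | Agree m y ∧ (y.1.2 : ℕ) = 0 ∧ (y.1.1 : ℕ) < m.1.1 ∧ (m.1.1 : ℕ) ≤ par y.1.1}
    else {y | Agree m y ∧ (((y.1.1 : ℕ) = m.1.1 ∧ (y.1.2 : ℕ) + 1 = m.1.2) ∨
      ((y.1.2 : ℕ) = 0 ∧ (y.1.1 : ℕ) = par m.1.1))}
  have hD0 {m y : X} (hm : (m.1.2 : ℕ) = 0) :
      y ∈ D m ↔ (m.1.1 : ℕ) ≤ forestLevel par y.1 ∧ Agree m y := by
    simp only [D, if_pos hm]
    exact Iff.rfl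
  have hD1 {m y : X} (hm : (m.1.2 : ℕ) ≠ 0) :
      y ∈ D m ↔ (y.1.1 : ℕ) = m.1.1 ∧ (m.1.2 : ℕ) ≤ y.1.2 ∧ Agree m y := by
    simp only [D, if_neg hm]
    exact Iff.rfl
  have hA0 {m y : X} (hm : (m.1.2 : ℕ) = 0) : y ∈ A m ↔
      Agree m y ∧ (y.1.2 : ℕ) = 0 ∧ (y.1.1 : ℕ) < m.1.1 ∧ (m.1.1 : ℕ) ≤ par y.1.1 := by
    simp only [A, if_pos hm]
    exact Iff.rfl
  have hA1 {m y : X} (hm : (m.1.2 : ℕ) ≠ 0) : y ∈ A m ↔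
      Agree m y ∧ (((y.1.1 : ℕ) = m.1.1 ∧ (y.1.2 : ℕ) + 1 = m.1.2) ∨
        ((y.1.2 : ℕ) = 0 ∧ (y.1.1 : ℕ) = par m.1.1)) := by
    simp only [A, if_neg hm]
    exact Iff.rfl
  refine density_le_of_rank hI φ hφ ρ D A ?_ ?_ ?_ ?_ ?_
  · intro m
    by_cases hm : (m.1.2 : ℕ) = 0
    · exact (hD0 hm).2 ⟨by rw [forestLevel, if_pos hm], Agree.refl m⟩
    · exact (hD1 hm).2 ⟨rfl, le_rfl, Agree.refl m⟩
  · intro m y hy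
    have := y.1.1.isLt
    have := m.1.1.isLt
    by_cases hm : (m.1.2 : ℕ) = 0
    · rw [hD0 hm] at hy
      simp only [ρ, if_pos hm]
      by_cases hy0 : (y.1.2 : ℕ) = 0
      · rw [forestLevel, if_pos hy0] at hy
        rw [if_pos hy0]
        rcases hy.1.eq_or_lt with h | h
        · exact Or.inl (hy.2.symm.eq (prod_fin_ext h.symm (by lia)))
        · exact Or.inr h
      · rw [if_neg hy0]
        lia
    · rw [hD1 hm] at hy
      simp only [ρ, if_neg hm]
      rcases hy.2.1.eq_or_lt with h | h
      · exact Or.inl (hy.2.2.symm.eq (prod_fin_ext hy.1 h.symm))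
      · rw [if_neg (by lia)]
        lia
  · intro m y hy
    have := y.1.1.isLt
    simp only [ρ]
    by_cases hm : (m.1.2 : ℕ) = 0
    · rw [hA0 hm] at hy
      rw [if_pos hm, if_pos hy.2.1]
      exact hy.2.2.1
    · rw [hA1 hm] at hy
      rw [if_neg hm]
      split_ifs <;> lia
  · rintro m x y hx ⟨hxy, hag⟩
    have hc := subdividedForest_adj_cases hxy
    have hxl := hP.lt_par x.1.1
    have hyl := hP.lt_par y.1.1
    by_cases hm : (m.1.2 : ℕ) = 0
    · rw [hD0 hm] at hx
      rw [hD0 hm, hA0 hm]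
      obtain ⟨hx1, hmx⟩ := hx
      have hmy : Agree m y := hmx.trans hag (Or.inl (by rwa [forestLevel, if_pos hm]))
      simp only [hmy, and_true, true_and]
      simp only [forestLevel] at hx1 ⊢
      grind
    · rw [hD1 hm] at hx
      rw [hD1 hm, hA1 hm]
      obtain ⟨hx1, hx2, hmx⟩ := hx
      have hmy : Agree m y := hmx.trans hag (Or.inl (by simp only [forestLevel]; grind))
      simp only [hmy, and_true, true_and]
      grind
  · intro m
    by_cases hm : (m.1.2 : ℕ) = 0
    · rcases le_or_gt k (r + 2) with hk | hk
      · left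
        refine le_trans ?_ ((hP.crossing m.1.1 m.1.1.isLt).trans hk)
        refine ncard_le_of_agree (m := m) (fun a => (a.1 : ℕ)) ?_ _ ?_
        · exact fun x hx y hy hxy => prod_fin_ext hxy
            (((hA0 hm).1 hx).2.1.trans ((hA0 hm).1 hy).2.1.symm)
        · intro y hy
          obtain ⟨h1, h2, h3, h4⟩ := (hA0 hm).1 hy
          refine ⟨h1, ?_, by simp [h3, h4]⟩
          simp only [forestLevel, if_pos hm, if_pos h2]
          exact h3.le
      · right
        intro m' hne hle p
        have hm' : (m'.1.2 : ℕ) = 0 := by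
          by_contra h
          have := m.1.1.isLt
          simp only [ρ, if_pos hm, if_neg h] at hle
          lia
        have := lt_length_of_walk_forestBlowup hP.lt_par hm hm' hne p
        -- Here `r + 2 < k` and `4 * k < s`, so the walk is longer than `4 * r + 1`.
        lia
    · left
      refine (ncard_le_of_agree (m := m) (fun a => ((a.1 : ℕ), (a.2 : ℕ))) ?_
        {((m.1.1 : ℕ), (m.1.2 : ℕ) - 1), (par m.1.1, 0)} ?_).trans
        (Finset.card_le_two.trans (by lia))
      · exact fun x hx y hy hxy => prod_fin_ext (congrArg Prod.fst hxy) (congrArg Prod.snd hxy)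
      · intro y hy
        obtain ⟨h1, h2⟩ := (hA1 hm).1 hy
        have := hP.lt_par m.1.1
        refine ⟨h1, ?_, ?_⟩
        · simp only [forestLevel]
          grind
        · simp only [Finset.mem_insert, Finset.mem_singleton, Prod.mk.injEq]
          lia

/-- This covers small `p`, where walks through the root may be too long: a single edge already
forces two colors. -/
theorem two_le_ncard_range_of_isPCentered_forestBlowup (hs : 0 < s) (hL : 0 < L)
    (hlt : ∀ i, i < par i) {p : ℕ} (hp : 1 ≤ p)
    (hN : 2 ^ Nat.card (Fin L × Fin (s + 1)) < N) {f}
    (hf : IsPCentered (forestBlowup par L s N) p f) :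
    2 ≤ (Set.range f).ncard := by
  have hadj : (subdividedForest par L s).Adj (⟨0, hL⟩, 0) (⟨0, hL⟩, ⟨1, by lia⟩) :=
    subdividedForest_adj_succ rfl rfl
  refine le_ncard_range_of_isPCentered ![(⟨0, hL⟩, 0), (⟨0, hL⟩, ⟨1, by lia⟩)] ?_ ?_ hN hf
  · intro i j hij
    fin_cases i <;> fin_cases j <;> simp_all [Fin.ext_iff]
  · intro i j hij
    obtain ⟨rfl, rfl⟩ : i = 0 ∧ j = 1 := by lia
    refine ⟨hadj.toWalk, by simpa using hp, ?_⟩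
    have := hlt 0
    simp [forestLevel]
    lia

theorem le_ncard_range_of_isPCentered_forestBlowup (hs : 0 < s) (hlt : ∀ i, i < par i)
    {d : ℕ → ℕ} {k p : ℕ} (hd : ∀ i < L, d i ≤ k)
    (hpar : ∀ i, i + 1 < L → par i < L ∧ d i = d (par i) + 1) (hp : 2 * ((s + 1) * k) ≤ p)
    (hN : L ^ Nat.card (Fin L × Fin (s + 1)) < N) {f}
    (hf : IsPCentered (forestBlowup par L s N) p f) : L ≤ (Set.range f).ncard := by
  refine le_ncard_range_of_isPCentered (fun i => (i, 0)) (fun i j h => congrArg Prod.fst h)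
    (fun i j hij => ?_) hN hf
  have hL : L - 1 < L := by lia
  obtain ⟨w, hw, hws⟩ := exists_walk_subdividedForest_root hs hlt hpar hL i
  obtain ⟨v, hv, hvs⟩ := exists_walk_subdividedForest_root hs hlt hpar hL j
  refine ⟨w.append v.reverse, ?_, fun a ha => ?_⟩
  · rw [Walk.length_append, Walk.length_reverse]
    have h1 := Nat.mul_le_mul_left (s + 1) (hd i i.isLt)
    have h2 := Nat.mul_le_mul_left (s + 1) (hd j j.isLt)
    lia
  · have h0 : forestLevel par (i, (0 : Fin (s + 1))) = i := rfl
    have h1 : forestLevel par (j, (0 : Fin (s + 1))) = j := rfl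
    have hij' : (i : ℕ) < j := hij
    rw [h0]
    rw [Walk.mem_support_append_iff, Walk.support_reverse, List.mem_reverse] at ha
    rcases ha with ha | ha
    · exact hws a ha
    · right
      rcases hvs a ha with rfl | h
      · exact hij'
      · exact hij'.trans h

end SubdividedForest

/-! ### The class and the choice of parameters -/

/-- The class of tree blow-ups of subdivided increasing forests, in which the number of subdivision
vertices exceeds four times the number of crossing arcs. -/
def forestBlowupClass : GraphClass where
  Mem {V} G := ∃ par L k N, IsIncreasingForest par L k ∧
    Nonempty (G ≃g forestBlowup par L (4 * k + 1) N)
  finite := by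
    rintro V G ⟨par, L, k, N, -, ⟨e⟩⟩
    exact Finite.of_equiv _ e.toEquiv.symm
  iso_closed := by
    rintro V V' G G' ⟨e⟩ ⟨par, L, k, N, h, ⟨e'⟩⟩
    exact ⟨par, L, k, N, h, ⟨e.symm.trans e'⟩⟩

theorem nabla_forestBlowupClass_le (r : ℕ) : forestBlowupClass.nabla r ≤ (r : ℝ≥0∞) + 2 := by
  refine iSup_le fun V => iSup_le fun G => iSup_le fun hG => iSup_le fun W => iSup_le fun _ =>
    iSup_le fun _ => iSup_le fun H => iSup_le fun ⟨I, hI⟩ => ?_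
  obtain ⟨par, L, k, N, hP, ⟨e⟩⟩ := hG
  have := density_le_of_isShallowMinorModel_forestBlowup hP (Nat.lt_succ_self _) hI e.toHom
    e.injective
  exact_mod_cast this

theorem polynomialExpansion_forestBlowupClass : forestBlowupClass.PolynomialExpansion := by
  refine ⟨Polynomial.X + 2, fun r => (nabla_forestBlowupClass_le r).trans_eq ?_⟩
  have : Polynomial.eval (r : ℝ) (Polynomial.X + 2) = ((r + 2 : ℕ) : ℝ) := by
    simp
  rw [this, ENNReal.ofReal_natCast]
  simp

theorem exists_forestBlowupClass_two_pow_le (p : ℕ) (hp : 1 ≤ p) :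
    ∃ (V : Type) (G : SimpleGraph V), forestBlowupClass.Mem G ∧ ∀ f : V → ℕ, IsPCentered G p f →
      (2 : ℝ) ^ ((1 / 8 : ℝ) * Real.sqrt p) ≤ ((Set.range f).ncard : ℝ) := by
  -- Take `k = ⌊√p / 4⌋`, or 1 if that is 0. With `s = 4k + 1`, walks through the root have length
  -- at most `2(4k + 2)k ≤ 16k^2`.
  obtain ⟨k, hk1, hk2, hk3⟩ : ∃ k : ℕ, 1 ≤ k ∧ Real.sqrt p ≤ 8 * k ∧ (k = 1 ∨ 16 * k ^ 2 ≤ p) := by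
    have h0 := Real.sqrt_nonneg (p : ℝ)
    have hlt := Nat.lt_floor_add_one (Real.sqrt p / 4)
    have hle := Nat.floor_le (show 0 ≤ Real.sqrt p / 4 by positivity)
    rcases Nat.eq_zero_or_pos ⌊Real.sqrt p / 4⌋₊ with h | h
    · refine ⟨1, le_rfl, ?_, Or.inl rfl⟩
      rw [h] at hlt
      push_cast at hlt ⊢
      linarith
    · refine ⟨⌊Real.sqrt p / 4⌋₊, h, ?_, Or.inr ?_⟩
      · have : (1 : ℝ) ≤ ⌊Real.sqrt p / 4⌋₊ := by exact_mod_cast h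
        linarith
      · have h1 : (4 * ⌊Real.sqrt p / 4⌋₊ : ℝ) ^ 2 ≤ p := by
          rw [← Real.le_sqrt (by positivity) (by positivity)]
          linarith
        have h2 : ((16 * ⌊Real.sqrt p / 4⌋₊ ^ 2 : ℕ) : ℝ) ≤ p := by
          push_cast
          linarith
        exact_mod_cast h2
  obtain ⟨par, d, hP, hd, hpar⟩ := exists_binomialTree k
  let N := (2 ^ k) ^ Nat.card (Fin (2 ^ k) × Fin (4 * k + 1 + 1)) + 1
  refine ⟨_, forestBlowup par (2 ^ k) (4 * k + 1) N, ⟨par, _, k, N, hP, ⟨Iso.refl⟩⟩,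
    fun f hf => ?_⟩
  have hcol : 2 ^ k ≤ (Set.range f).ncard := by
    rcases hk3 with rfl | hk3
    · exact two_le_ncard_range_of_isPCentered_forestBlowup (by lia) (by simp) hP.lt_par hp
        (Nat.lt_succ_self _) hf
    · exact le_ncard_range_of_isPCentered_forestBlowup (by lia) hP.lt_par hd hpar
        (by nlinarith) (Nat.lt_succ_self _) hf
  calc (2 : ℝ) ^ ((1 / 8 : ℝ) * Real.sqrt p) ≤ (2 : ℝ) ^ (k : ℝ) :=
        Real.rpow_le_rpow_of_exponent_le (by norm_num) (by linarith)
    _ = ((2 ^ k : ℕ) : ℝ) := by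
        rw [Real.rpow_natCast]
        push_cast
        rfl
    _ ≤ _ := by exact_mod_cast hcol

end Sparsity

theorem theorem1 :
    ∃ (𝒢 : Sparsity.GraphClass) (c : ℝ), 0 < c ∧
      𝒢.PolynomialExpansion ∧
      (∀ r : ℕ, 𝒢.nabla r ≤ (r : ℝ≥0∞) + 2) ∧
      ∀ p : ℕ, 1 ≤ p →
        ∃ (V : Type) (G : SimpleGraph V), 𝒢.Mem G ∧
          ∀ f : V → ℕ, Sparsity.IsPCentered G p f →
            (2 : ℝ) ^ (c * Real.sqrt (p : ℝ)) ≤ ((Set.range f).ncard : ℝ) :=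
  ⟨Sparsity.forestBlowupClass, 1 / 8, by norm_num, Sparsity.polynomialExpansion_forestBlowupClass,
    Sparsity.nabla_forestBlowupClass_le, Sparsity.exists_forestBlowupClass_two_pow_le⟩
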